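/- Theorem 1. All graphs are finite, undirected and simple. Let $a,b$ be integers with $1\le a\le b$, and let $G$ be a graph of order $n$ with $$n\ \ge\ \frac{(a+2b)(2a+2b-3)+1}{b}\qquad\text{and}\qquad \delta(G)\ \ge\ \frac{bn}{a+2b}+a,$$ where $\delta(G)$ is the minimum degree of $G$. Suppose that $$|N_G(x)\cup N_G(y)|\ \ge\ \frac{(a+b)n}{a+2b}$$ for any two distinct nonadjacent vertices $x,y$ of $G$, where $N_G(x)$ is the set of vertices adjacent to $x$. Then $G$ is fractional ID-$[a,b]$-factor-critical; that is, for every independent set $I$ of $G$, the induced subgraph $G-I=G[V(G)\setminus I]$ has a fractional $[a,b]$-factor. Here a graph $H$ has a fractional $[a,b]$-factor if there is a function $h\colon E(H)\to[0,1]$ with $$a\ \le\ \sum_{e\ni x}h(e)\ \le\ b\qquad\text{for every vertex } x \text{ of } H .$$ -/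

import Mathlib

open Classical in
/-- `h : E(G) → [0,1]` is an indicator function of a fractional `[a,b]`-factor of the finite
graph `G`: at every vertex `x` the sum of `h` over the edges incident with `x` lies between
`a` and `b`. -/
def SimpleGraph.IsFractionalFactorIndicator {V : Type*} [Fintype V] (G : SimpleGraph V)
    (a b : ℕ) (h : G.edgeSet → ℝ) : Prop :=
  (∀ e, 0 ≤ h e ∧ h e ≤ 1) ∧
    ∀ x : V, (a : ℝ) ≤ ∑ e ∈ Finset.univ.filter (fun e : G.edgeSet => x ∈ (e : Sym2 V)), h e ∧
      ∑ e ∈ Finset.univ.filter (fun e : G.edgeSet => x ∈ (e : Sym2 V)), h e ≤ (b : ℝ)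

/-- `G` has a fractional `[a,b]`-factor. -/
def SimpleGraph.HasFractionalFactor {V : Type*} [Fintype V] (G : SimpleGraph V)
    (a b : ℕ) : Prop :=
  ∃ h : G.edgeSet → ℝ, G.IsFractionalFactorIndicator a b h

open Classical in
/-- `G` is fractional ID-`[a,b]`-factor-critical: for every independent set `I` of `G`, the
graph `G - I` induced on the complement of `I` has a fractional `[a,b]`-factor. -/
def SimpleGraph.IsFractionalIDFactorCritical {V : Type*} [Fintype V] (G : SimpleGraph V)
    (a b : ℕ) : Prop :=
  ∀ I : Set V, G.IsIndepSet I → (G.induce Iᶜ).HasFractionalFactor a b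

/-!
The proof has two halves.

*A criterion for fractional `[a,b]`-factors* (`hasFractionalFactor_of_forall_disjoint`). A graph
has a fractional `[a,b]`-factor as soon as `a|T| ≤ b|S| + ∑_{x ∈ T} d_{G-S}(x)` for all disjoint
vertex sets `S`, `T` such that `d_{G-S}(x) < a` on `T`. The degree vectors of functions
`h : E → [0,1]` form a compact convex set; if it misses the box `[a,b]^V`, the Hahn-Banach theorem
yields weights `w` on the vertices with
`∑_{xy ∈ E} (w x + w y)⁺ < ∑_x (a (w x)⁺ - b (w x)⁻)`.
For `t > 0` put `T_t = {w ≥ t}` and `S_t = {w ≤ -t}`. Integrated over `t`, the inequalities of the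
criterion for the pairs `(S_t, T_t)` become the reverse of this strict inequality.

*Checking the criterion* (`hasFractionalFactor_of_card_neighborFinset_union`). Let `H = G - I`, with
`|I| = i`. Independence of `I` and the neighbourhood hypothesis give `i ≤ bn/(a+2b)`, hence
`δ(H) ≥ δ(G) - i ≥ a`. Given `S` and a nonempty `T`, let `x₁ ∈ T` minimise `h₁ = d_{H-S}`. If `x₁` is adjacent
to all the rest of `T`, then `|T| ≤ h₁ + 1 ≤ b` while `|S| ≥ a - h₁`, which suffices. Otherwise let
`x₂` minimise `h₂ = d_{H-S}` among the remaining vertices of `T`: the union condition for `x₁, x₂`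
bounds `|S|` from below, the size of `H` bounds `|T|` from above, and
the lower bound on `n` is exactly what makes the deficiency exceed `-1`; being an integer, it is
nonnegative.
-/

open Finset

namespace SimpleGraph

section Criterion

/-! ### A sufficient condition for fractional factors -/

variable {W : Type*} [Fintype W]

open Classical in
/-- The neighbours of `x` outside `S`; for `x ∉ S` their number is the degree of `x` in `H - S`. -/
noncomputable def neighborsAvoiding (H : SimpleGraph W) (S : Finset W) (x : W) : Finset W :=
  {y | H.Adj x y ∧ y ∉ S}

@[simp]
lemma mem_neighborsAvoiding {H : SimpleGraph W} {S : Finset W} {x y : W} :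
    y ∈ H.neighborsAvoiding S x ↔ H.Adj x y ∧ y ∉ S := by
  simp [neighborsAvoiding]

open Classical in
/-- The linear map sending a weight function on unordered pairs to its weighted degrees in `H`.
Pairs that are not edges of `H` do not contribute. -/
noncomputable def weightedDegree (H : SimpleGraph W) : (Sym2 W → ℝ) →ₗ[ℝ] (W → ℝ) where
  toFun h x := ∑ y, if H.Adj x y then h s(x, y) else 0
  map_add' h k := by
    ext x
    simp only [Pi.add_apply, ← sum_add_distrib]
    exact sum_congr rfl fun y _ => by split_ifs <;> simp
  map_smul' c h := by
    ext x
    simp only [Pi.smul_apply, smul_eq_mul, RingHom.id_apply, mul_sum]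
    exact sum_congr rfl fun y _ => by split_ifs <;> simp

open Classical in
lemma weightedDegree_apply (H : SimpleGraph W) (h : Sym2 W → ℝ) (x : W) :
    H.weightedDegree h x = ∑ y, if H.Adj x y then h s(x, y) else 0 := rfl

open Classical in
lemma sum_incident_eq_weightedDegree (H : SimpleGraph W) (h : Sym2 W → ℝ) (x : W) :
    ∑ e ∈ univ.filter (fun e : H.edgeSet => x ∈ (e : Sym2 W)), h e = H.weightedDegree h x := by
  rw [weightedDegree_apply, ← sum_filter]
  symm
  refine sum_bij (fun y hy => ⟨s(x, y), by simpa using hy⟩) ?_ ?_ ?_ ?_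
  · intro y _
    simp
  · intro y _ z _ hyz
    exact Sym2.congr_right.1 (congrArg Subtype.val hyz)
  · rintro ⟨e, he⟩ hx
    obtain ⟨y, rfl⟩ : ∃ y, e = s(x, y) := Sym2.mem_iff_exists.1 (by simpa using hx)
    exact ⟨y, by simpa using he, rfl⟩
  · intro y _
    rfl

lemma hasFractionalFactor_of_weightedDegree (H : SimpleGraph W) (a b : ℕ) (h : Sym2 W → ℝ)
    (h01 : h ∈ Set.Icc (0 : Sym2 W → ℝ) 1)
    (hd : H.weightedDegree h ∈ Set.Icc (fun _ => (a : ℝ)) (fun _ => (b : ℝ))) :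
    H.HasFractionalFactor a b := by
  refine ⟨fun e => h e, fun e => ⟨h01.1 e, h01.2 e⟩, fun x => ?_⟩
  rw [sum_incident_eq_weightedDegree]
  exact ⟨hd.1 x, hd.2 x⟩

/-- `max (u - max 0 (-v)) 0` is the length of `{t > 0 | -v < t ≤ u}`. It differs from `u`, switched
off unless `u + v > 0`, by an antisymmetric function of `(u, v)`, so the two have equal sums over
the ordered pairs of adjacent vertices. -/
lemma max_sub_max_add_swap (u v : ℝ) :
    max (u - max 0 (-v)) 0 + max (v - max 0 (-u)) 0 =
      (if 0 < u + v then u else 0) + (if 0 < v + u then v else 0) := by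
  rw [add_comm v u]
  rcases le_total 0 (-v) with hv | hv <;> rcases le_total 0 (-u) with hu | hu <;>
    simp only [hv, hu, max_eq_left, max_eq_right] <;> split_ifs with h <;>
    (try rw [max_eq_left (by linarith)]) <;> (try rw [max_eq_right (by linarith)]) <;>
    (try rw [max_eq_left (by linarith)]) <;> (try rw [max_eq_right (by linarith)]) <;> linarith

open Classical in
/-- The inequality that the separating functional `w` would violate, obtained by
integrating `hcrit` over the level sets of `w`. -/
lemma sum_le_of_forall_disjoint (H : SimpleGraph W) (a b : ℕ) (w : W → ℝ)
    (hcrit : ∀ S T : Finset W, Disjoint S T →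
      a * #T ≤ b * #S + ∑ x ∈ T, #(H.neighborsAvoiding S x)) :
    ∑ x, w x * (if 0 ≤ w x then (a : ℝ) else b) ≤
      ∑ x, ∑ y, if H.Adj x y then (if 0 < w x + w y then w x else 0) else 0 := by
  let φ : ℝ → ℝ := fun t =>
    (∑ x, (b : ℝ) * (Set.Ioc 0 (-w x)).indicator 1 t +
      ∑ x, ∑ y, (if H.Adj x y then (1 : ℝ) else 0) *
        (Set.Ioc (max 0 (-w y)) (w x)).indicator 1 t) -
    ∑ x, (a : ℝ) * (Set.Ioc 0 (w x)).indicator 1 t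
  have hint (u v : ℝ) : MeasureTheory.Integrable ((Set.Ioc u v).indicator (1 : ℝ → ℝ)) :=
    (MeasureTheory.integrable_indicator_iff measurableSet_Ioc).2
      (MeasureTheory.integrableOn_const (by simp) (by simp))
  have hval (u v : ℝ) : ∫ t, (Set.Ioc u v).indicator (1 : ℝ → ℝ) t = max (v - u) 0 := by
    rw [MeasureTheory.integral_indicator_one measurableSet_Ioc, Real.volume_real_Ioc]
  have hφ : 0 ≤ φ := by
    intro t
    rcases le_or_gt t 0 with ht | ht
    · -- No level set is considered at `t ≤ 0`: all indicators vanish.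
      have h0 (u v : ℝ) (hu : 0 ≤ u) : (Set.Ioc u v).indicator (1 : ℝ → ℝ) t = 0 :=
        Set.indicator_of_notMem (fun h => by linarith [h.1]) _
      simp [φ, h0]
    · have key := hcrit {x | w x ≤ -t} {x | t ≤ w x} (by
        rw [Finset.disjoint_left]
        intro x hx hx'
        simp only [mem_filter_univ] at hx hx'
        linarith)
      have key' : (a : ℝ) * #{x | t ≤ w x} ≤ b * #{x | w x ≤ -t} +
          ∑ x ∈ {x | t ≤ w x}, (#(H.neighborsAvoiding {x | w x ≤ -t} x) : ℝ) := by
        exact_mod_cast key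
      have e1 : ∑ x, (b : ℝ) * (Set.Ioc 0 (-w x)).indicator 1 t = b * #{x | w x ≤ -t} := by
        rw [← mul_sum, Finset.card_filter, Nat.cast_sum]
        congr 1
        refine sum_congr rfl fun x _ => ?_
        by_cases h : w x ≤ -t <;> simp [ht, h, le_neg]
      have e2 : ∑ x, (a : ℝ) * (Set.Ioc 0 (w x)).indicator 1 t = a * #{x | t ≤ w x} := by
        rw [← mul_sum, Finset.card_filter, Nat.cast_sum]
        congr 1
        refine sum_congr rfl fun x _ => ?_
        by_cases h : t ≤ w x <;> simp [ht, h]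
      have e3 : ∑ x, ∑ y, (if H.Adj x y then (1 : ℝ) else 0) *
          (Set.Ioc (max 0 (-w y)) (w x)).indicator 1 t =
          ∑ x ∈ {x | t ≤ w x}, (#(H.neighborsAvoiding {x | w x ≤ -t} x) : ℝ) := by
        rw [sum_filter]
        refine sum_congr rfl fun x _ => ?_
        split_ifs with hx
        · rw [neighborsAvoiding, Finset.card_filter, Nat.cast_sum]
          refine sum_congr rfl fun y _ => ?_
          have : (-w y < t) ↔ ¬ w y ≤ -t := by rw [not_le, neg_lt]
          by_cases h : H.Adj x y <;> by_cases h' : w y ≤ -t <;>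
            simp [ht, hx, h, h', this]
        · refine sum_eq_zero fun y _ => ?_
          simp [hx]
      simp only [φ, e1, e2, e3, Pi.zero_apply]
      linarith
  have hI : 0 ≤ ∫ t, φ t := MeasureTheory.integral_nonneg hφ
  have hcalc : ∫ t, φ t = (∑ x, (b : ℝ) * max (-w x) 0 +
      ∑ x, ∑ y, (if H.Adj x y then (1 : ℝ) else 0) * max (w x - max 0 (-w y)) 0) -
      ∑ x, (a : ℝ) * max (w x) 0 := by
    have i1 : ∀ x ∈ (univ : Finset W), MeasureTheory.Integrable
        (fun t => (b : ℝ) * (Set.Ioc 0 (-w x)).indicator 1 t) :=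
      fun x _ => (hint _ _).const_mul _
    have i2 : ∀ x ∈ (univ : Finset W), MeasureTheory.Integrable
        (fun t => (a : ℝ) * (Set.Ioc 0 (w x)).indicator 1 t) :=
      fun x _ => (hint _ _).const_mul _
    have i3 : ∀ x, ∀ y ∈ (univ : Finset W), MeasureTheory.Integrable
        (fun t => (if H.Adj x y then (1 : ℝ) else 0) *
          (Set.Ioc (max 0 (-w y)) (w x)).indicator 1 t) :=
      fun x y _ => (hint _ _).const_mul _
    have i4 : ∀ x ∈ (univ : Finset W), MeasureTheory.Integrable
        (fun t => ∑ y, (if H.Adj x y then (1 : ℝ) else 0) *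
          (Set.Ioc (max 0 (-w y)) (w x)).indicator 1 t) :=
      fun x _ => MeasureTheory.integrable_finsetSum _ (i3 x)
    have i5 := (MeasureTheory.integrable_finsetSum _ i1).fun_add
      (MeasureTheory.integrable_finsetSum _ i4)
    simp only [φ]
    rw [MeasureTheory.integral_sub i5 (MeasureTheory.integrable_finsetSum _ i2),
      MeasureTheory.integral_add (MeasureTheory.integrable_finsetSum _ i1)
        (MeasureTheory.integrable_finsetSum _ i4),
      MeasureTheory.integral_finsetSum _ i1, MeasureTheory.integral_finsetSum _ i2,
      MeasureTheory.integral_finsetSum _ i4]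
    simp only [MeasureTheory.integral_const_mul, hval, sub_zero]
    congr 2
    refine sum_congr rfl fun x _ => ?_
    rw [MeasureTheory.integral_finsetSum _ (i3 x)]
    simp only [MeasureTheory.integral_const_mul, hval]
  have hswap : ∑ x, ∑ y, (if H.Adj x y then (1 : ℝ) else 0) * max (w x - max 0 (-w y)) 0 =
      ∑ x, ∑ y, if H.Adj x y then (if 0 < w x + w y then w x else 0) else 0 := by
    -- Both double sums are compared after adding their transposes.
    have h2 (F : W → W → ℝ) : 2 * ∑ x, ∑ y, F x y = ∑ x, ∑ y, (F x y + F y x) := by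
      rw [two_mul]
      conv_lhs => arg 2; rw [sum_comm]
      simp only [← sum_add_distrib]
    refine mul_left_cancel₀ (two_ne_zero' ℝ) ?_
    rw [h2, h2]
    refine sum_congr rfl fun x _ => sum_congr rfl fun y _ => ?_
    by_cases h : H.Adj x y
    · simpa [h, h.symm] using max_sub_max_add_swap (w x) (w y)
    · simp [h, H.adj_comm y x]
  have hsplit : ∑ x, w x * (if 0 ≤ w x then (a : ℝ) else b) =
      ∑ x, (a : ℝ) * max (w x) 0 - ∑ x, (b : ℝ) * max (-w x) 0 := by
    rw [← sum_sub_distrib]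
    refine sum_congr rfl fun x _ => ?_
    split_ifs with h
    · rw [max_eq_left h, max_eq_right (by linarith)]; ring
    · rw [max_eq_right (by linarith), max_eq_left (by linarith)]; ring
  rw [hsplit, ← hswap]
  linarith

/-- The sufficient half of the fractional `[a,b]`-factor theorem. -/
theorem hasFractionalFactor_of_forall_disjoint (H : SimpleGraph W) (a b : ℕ) (hab : a ≤ b)
    (hcrit : ∀ S T : Finset W, Disjoint S T → (∀ x ∈ T, #(H.neighborsAvoiding S x) < a) →
      a * #T ≤ b * #S + ∑ x ∈ T, #(H.neighborsAvoiding S x)) :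
    H.HasFractionalFactor a b := by
  classical
  -- Vertices of `T` with at least `a` neighbours outside `S` only help.
  have hcrit' : ∀ S T : Finset W, Disjoint S T →
      a * #T ≤ b * #S + ∑ x ∈ T, #(H.neighborsAvoiding S x) := by
    intro S T hST
    have h1 := hcrit S {x ∈ T | #(H.neighborsAvoiding S x) < a}
      (hST.mono_right (filter_subset _ _)) (fun x hx => (mem_filter.1 hx).2)
    have h2 : #{x ∈ T | ¬ #(H.neighborsAvoiding S x) < a} * a ≤
        ∑ x ∈ T with ¬ #(H.neighborsAvoiding S x) < a, #(H.neighborsAvoiding S x) := by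
      rw [← smul_eq_mul]
      exact card_nsmul_le_sum _ _ _ fun x hx => not_lt.1 (mem_filter.1 hx).2
    have h3 := sum_filter_add_sum_filter_not T (fun x => #(H.neighborsAvoiding S x) < a)
      (fun x => #(H.neighborsAvoiding S x))
    have h4 := card_filter_add_card_filter_not (s := T)
      (fun x => #(H.neighborsAvoiding S x) < a)
    rw [← h4]
    nlinarith
  by_contra hno
  have hdisj : Disjoint (H.weightedDegree '' Set.Icc (0 : Sym2 W → ℝ) 1)
      (Set.Icc (fun _ : W => (a : ℝ)) (fun _ => (b : ℝ))) := by
    rw [Set.disjoint_left]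
    rintro _ ⟨h, h01, rfl⟩ hd
    exact hno (H.hasFractionalFactor_of_weightedDegree a b h h01 hd)
  obtain ⟨f, u, v, hu, huv, hv⟩ := geometric_hahn_banach_compact_closed
    ((convex_Icc _ _).linear_image H.weightedDegree)
    (isCompact_Icc.image H.weightedDegree.continuous_of_finiteDimensional)
    (convex_Icc _ _) isClosed_Icc hdisj
  let w : W → ℝ := fun x => f (Pi.single x 1)
  have hf (d : W → ℝ) : f d = ∑ x, d x * w x := by
    conv_lhs => rw [← univ_sum_single d, map_sum]
    refine sum_congr rfl fun x _ => ?_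
    rw [← smul_eq_mul, ← map_smul, ← Pi.single_smul, smul_eq_mul, mul_one]
  -- The extreme points: weight one on the edges with `w x + w y > 0`, and the corner of the box
  -- minimising `w`.
  let h : Sym2 W → ℝ := fun e => if 0 < (e.map w).lift ⟨(· + ·), add_comm⟩ then 1 else 0
  have hh : h ∈ Set.Icc (0 : Sym2 W → ℝ) 1 := by
    constructor <;> intro e <;> simp only [h] <;> split_ifs <;> simp
  have h1 := hu _ ⟨h, hh, rfl⟩
  have h2 := hv (fun x => if 0 ≤ w x then (a : ℝ) else b) (by
    have : (a : ℝ) ≤ b := by exact_mod_cast hab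
    constructor <;> intro x <;> dsimp only <;> split_ifs <;> simp [this])
  rw [hf] at h1 h2
  have h3 := sum_le_of_forall_disjoint H a b w hcrit'
  have h4 : ∑ x, H.weightedDegree h x * w x =
      ∑ x, ∑ y, if H.Adj x y then (if 0 < w x + w y then w x else 0) else 0 := by
    refine sum_congr rfl fun x _ => ?_
    rw [weightedDegree_apply, sum_mul]
    refine sum_congr rfl fun y _ => ?_
    by_cases hxy : 0 < w x + w y <;> simp [h, hxy]
  simp only [mul_comm _ (w _)] at h2 h4 h1
  linarith

end Criterion

section NeighborhoodUnion

/-! ### Neighbourhood unions -/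

/-- The numerical core. For nonadjacent `x₁, x₂` with `p, q` neighbours outside
`S`, the quantity `b|S| + (p - q)(p + 1) - (a - q)|T|` exceeds `-1`; here `s = |S|`, `τ = |T|`,
`i` is the number of removed vertices and `m = n / (a + 2b)`. -/
lemma neg_one_lt_deficiency {a b p q : ℕ} (hab : a ≤ b) (hpq : p ≤ q)
    (hqa : q < a) {m i s τ : ℝ}
    (hm : 2 * (a : ℝ) + 2 * b - 3 < b * m) (hi : i ≤ b * m) (hs : (a + b) * m - i ≤ s + p + q)
    (hτ : s + τ ≤ (a + 2 * b) * m - i) :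
    -1 < b * s + ((p : ℝ) - q) * (p + 1) - ((a : ℝ) - q) * τ := by
  have hpq' : (p : ℝ) ≤ q := by exact_mod_cast hpq
  have hqa' : (q : ℝ) + 1 ≤ a := by exact_mod_cast hqa
  have hab' : (a : ℝ) ≤ b := by exact_mod_cast hab
  -- Substituting the bounds on `τ`, `s` and `i`, in this order, leaves an expression in `m`.
  have h1 : q * (b * m) - (a + b - q) * (p + q) + ((p : ℝ) - q) * (p + 1) ≤
      b * s + ((p : ℝ) - q) * (p + 1) - ((a : ℝ) - q) * τ := by
    have e1 := mul_le_mul_of_nonneg_left hτ (show 0 ≤ (a : ℝ) - q by linarith)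
    have e2 := mul_le_mul_of_nonneg_left hs (show 0 ≤ (a : ℝ) + b - q by linarith)
    have e3 := mul_le_mul_of_nonneg_left hi (show 0 ≤ (b : ℝ) by linarith)
    linarith
  refine lt_of_lt_of_le ?_ h1
  obtain rfl | hq := Nat.eq_zero_or_pos q
  · obtain rfl : p = 0 := Nat.le_zero.1 hpq
    simp
  · have hq' : (1 : ℝ) ≤ q := by exact_mod_cast hq
    have e1 := mul_lt_mul_of_pos_left hm (show 0 < (q : ℝ) by linarith)
    -- What remains is `q (2q - 3) + (q - p)(a + b - q - p - 1)`, and `q (2q - 3) ≥ -1`.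
    have e2 : 0 ≤ ((q : ℝ) - p) * (a + b - q - p - 1) :=
      mul_nonneg (by linarith) (by linarith)
    have e3 : 0 ≤ ((q : ℝ) - 1) * (2 * q - 1) := mul_nonneg (by linarith) (by linarith)
    linarith

/-- The criterion holds in a graph with `n - i` vertices, minimum degree at least `a` and large
neighbourhood unions. The parameter `i` is the size of the independent set removed from a graph of
order `n`. -/
theorem hasFractionalFactor_of_card_neighborFinset_union {W : Type*} [Fintype W] [DecidableEq W]
    (H : SimpleGraph W) [DecidableRel H.Adj] {a b : ℕ} (hab : a ≤ b) {m i : ℝ}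
    (hm : 2 * (a : ℝ) + 2 * b - 3 < b * m) (hi : i ≤ b * m)
    (hcard : (Fintype.card W : ℝ) = (a + 2 * b) * m - i)
    (hdeg : ∀ x, a ≤ H.degree x)
    (hnbr : ∀ x y, x ≠ y → ¬ H.Adj x y →
      (a + b) * m - i ≤ #(H.neighborFinset x ∪ H.neighborFinset y)) :
    H.HasFractionalFactor a b := by
  refine H.hasFractionalFactor_of_forall_disjoint a b hab fun S T hST hT => ?_
  obtain rfl | hne := T.eq_empty_or_nonempty
  · simp
  have hsub (x : W) : H.neighborFinset x ⊆ S ∪ H.neighborsAvoiding S x := by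
    intro y hy
    by_cases h : y ∈ S <;> simp_all
  obtain ⟨x₁, hx₁, hmin₁⟩ := T.exists_min_image (fun x => #(H.neighborsAvoiding S x)) hne
  set p := #(H.neighborsAvoiding S x₁) with hp
  have hpa : p < a := hT x₁ hx₁
  -- The closed neighbourhood of `x₁` inside `T`.
  let N : Finset W := {x ∈ T | x = x₁ ∨ H.Adj x₁ x}
  have hN : #N ≤ p + 1 := by
    have : N ⊆ insert x₁ (H.neighborsAvoiding S x₁) := by
      intro x hx
      simp only [N, mem_filter] at hx
      simp only [mem_insert, mem_neighborsAvoiding]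
      exact hx.2.imp_right fun h => ⟨h, fun hS => Finset.disjoint_left.1 hST hS hx.1⟩
    exact (card_le_card this).trans (card_insert_le _ _)
  by_cases hcl : T \ N = ∅
  · have hTN : #T ≤ p + 1 := (card_le_card (sdiff_eq_empty_iff_subset.1 hcl)).trans hN
    have hsum : #T * p ≤ ∑ x ∈ T, #(H.neighborsAvoiding S x) := by
      rw [← smul_eq_mul]
      exact card_nsmul_le_sum _ _ _ hmin₁
    have hS : a ≤ #S + p :=
      (hdeg x₁).trans ((card_le_card (hsub x₁)).trans (card_union_le _ _))
    obtain ⟨k, rfl⟩ := Nat.exists_eq_add_of_le hpa.le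
    nlinarith [Nat.mul_le_mul (show #T ≤ b by lia) (show k ≤ #S by lia)]
  · obtain ⟨x₂, hx₂, hmin₂⟩ := (T \ N).exists_min_image (fun x => #(H.neighborsAvoiding S x))
      (nonempty_iff_ne_empty.2 hcl)
    set q := #(H.neighborsAvoiding S x₂) with hq
    have hx₂' : x₂ ∈ T ∧ ¬ (x₂ = x₁ ∨ H.Adj x₁ x₂) := by
      rw [mem_sdiff, mem_filter, not_and] at hx₂
      exact ⟨hx₂.1, hx₂.2 hx₂.1⟩
    obtain ⟨hx₂T, hx₂n⟩ := hx₂'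
    rw [not_or] at hx₂n
    have hs : (a + b) * m - i ≤ (#S : ℝ) + p + q := by
      refine (hnbr x₁ x₂ (Ne.symm hx₂n.1) hx₂n.2).trans ?_
      have h1 : H.neighborFinset x₁ ∪ H.neighborFinset x₂ ⊆
          S ∪ H.neighborsAvoiding S x₁ ∪ H.neighborsAvoiding S x₂ := by
        intro y hy
        have h1 := @hsub x₁ y
        have h2 := @hsub x₂ y
        simp only [mem_union] at hy h1 h2 ⊢
        tauto
      have h2 := (card_le_card h1).trans ((card_union_le _ _).trans
        (Nat.add_le_add_right (card_union_le _ _) _))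
      exact_mod_cast h2
    have hτ : (#S : ℝ) + #T ≤ (a + 2 * b) * m - i := by
      rw [← hcard, ← Nat.cast_add, ← card_union_of_disjoint hST]
      exact_mod_cast card_le_univ _
    have hpq : p ≤ q := hmin₁ x₂ hx₂T
    have key := neg_one_lt_deficiency hab hpq (hT x₂ hx₂T) hm hi hs hτ
    have hsum : #N * p + #(T \ N) * q ≤ ∑ x ∈ T, #(H.neighborsAvoiding S x) := by
      rw [← sum_sdiff (filter_subset _ _ : N ⊆ T), add_comm]
      refine Nat.add_le_add ?_ ?_ <;> rw [← smul_eq_mul]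
      · exact card_nsmul_le_sum _ _ _ hmin₂
      · exact card_nsmul_le_sum _ _ _ fun x hx => hmin₁ x (mem_filter.1 hx).1
    have hTcard : #(T \ N) + #N = #T := card_sdiff_add_card_eq_card (filter_subset _ _)
    by_contra! hlt
    -- Integrality turns the negated goal into a deficiency of at most `-1`.
    have hlt' : (b : ℝ) * #S + (∑ x ∈ T, #(H.neighborsAvoiding S x) : ℕ) + 1 ≤ a * #T := by
      exact_mod_cast hlt
    have hsum' : (#N : ℝ) * p + #(T \ N) * q ≤ (∑ x ∈ T, #(H.neighborsAvoiding S x) : ℕ) := by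
      exact_mod_cast hsum
    have hTcard' : (#(T \ N) : ℝ) + #N = #T := by exact_mod_cast hTcard
    have hN' : (#N : ℝ) ≤ p + 1 := by exact_mod_cast hN
    have hpq' : (p : ℝ) ≤ q := by exact_mod_cast hpq
    have hTN : (#(T \ N) : ℝ) = #T - #N := by linarith
    rw [hTN] at hsum'
    nlinarith [mul_nonneg (sub_nonneg.2 hpq') (sub_nonneg.2 hN')]

end NeighborhoodUnion

/-! ### Deleting an independent set -/

section Induce

variable {V : Type*} [Fintype V] [DecidableEq V]

lemma card_neighborFinset_union_le_induce_compl (G : SimpleGraph V) [DecidableRel G.Adj]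
    (I : Finset V) [Fintype ↥((I : Set V)ᶜ)] [DecidableEq ↥((I : Set V)ᶜ)]
    [DecidableRel (G.induce (I : Set V)ᶜ).Adj] (x y : ↥((I : Set V)ᶜ)) :
    #(G.neighborFinset x ∪ G.neighborFinset y) ≤
      #I + #((G.induce (I : Set V)ᶜ).neighborFinset x ∪
        (G.induce (I : Set V)ᶜ).neighborFinset y) := by
  have hsub : G.neighborFinset x ∪ G.neighborFinset y ⊆
      I ∪ ((G.induce (I : Set V)ᶜ).neighborFinset x ∪
        (G.induce (I : Set V)ᶜ).neighborFinset y).map (Function.Embedding.subtype _) := by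
    intro z hz
    by_cases h : z ∈ I
    · simp [h]
    · simp_all
  simpa using (card_le_card hsub).trans (card_union_le _ _)

/-- Two vertices of an independent set have all their neighbours outside of it. -/
lemma IsIndepSet.card_add_card_neighborFinset_union_le {G : SimpleGraph V} [DecidableRel G.Adj]
    {I : Finset V} (hI : G.IsIndepSet (I : Set V)) {x y : V} (hx : x ∈ I) (hy : y ∈ I) :
    #I + #(G.neighborFinset x ∪ G.neighborFinset y) ≤ Fintype.card V := by
  have hd : Disjoint I (G.neighborFinset x ∪ G.neighborFinset y) := by
    rw [Finset.disjoint_left]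
    intro z hz h
    simp only [mem_union, mem_neighborFinset] at h
    rcases h with h | h
    · exact hI hx hz h.ne h
    · exact hI hy hz h.ne h
  rw [← card_union_of_disjoint hd]
  exact card_le_univ _

end Induce

end SimpleGraph

open SimpleGraph in
theorem theorem1 {V : Type*} [Fintype V] [DecidableEq V] (G : SimpleGraph V)
    [DecidableRel G.Adj] (a b n : ℕ) (ha : 1 ≤ a) (hab : a ≤ b)
    (hcard : Fintype.card V = n)
    (hn : (((a : ℝ) + 2 * b) * (2 * a + 2 * b - 3) + 1) / b ≤ (n : ℝ))
    (hdeg : (b : ℝ) * n / (a + 2 * b) + a ≤ (G.minDegree : ℝ))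
    (hnbr : ∀ x y : V, x ≠ y → ¬ G.Adj x y →
      ((a : ℝ) + b) * n / (a + 2 * b) ≤
        ((G.neighborFinset x ∪ G.neighborFinset y).card : ℝ)) :
    G.IsFractionalIDFactorCritical a b := by
  classical
  intro I' hI'
  obtain ⟨I, rfl⟩ : ∃ I : Finset V, (I : Set V) = I' := ⟨I'.toFinset, by simp⟩
  have ha' : (1 : ℝ) ≤ a := by exact_mod_cast ha
  have hb' : (1 : ℝ) ≤ b := by exact_mod_cast ha.trans hab
  have hpos : (0 : ℝ) < a + 2 * b := by linarith
  obtain ⟨m, hm⟩ : ∃ m : ℝ, (n : ℝ) = (a + 2 * b) * m :=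
    ⟨n / (a + 2 * b), by field_simp⟩
  have hquot (c : ℝ) : c * n / (a + 2 * b) = c * m := by
    rw [hm]; field_simp
  rw [hquot] at hdeg
  simp only [hquot] at hnbr
  have hbm : 2 * (a : ℝ) + 2 * b - 3 < b * m := by
    rw [div_le_iff₀ (by linarith), hm] at hn
    refine lt_of_mul_lt_mul_left ?_ hpos.le
    linarith
  have hIcard : (#I : ℝ) ≤ b * m := by
    by_cases h : #I ≤ 1
    · have : (#I : ℝ) ≤ 1 := by exact_mod_cast h
      linarith
    · obtain ⟨x, hx, y, hy, hxy⟩ := Finset.one_lt_card.1 (not_le.1 h)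
      have h1 := hnbr x y hxy (hI' hx hy hxy)
      have h2 := hI'.card_add_card_neighborFinset_union_le hx hy
      rw [hcard] at h2
      have h3 : (#I : ℝ) + #(G.neighborFinset x ∪ G.neighborFinset y) ≤ n := by exact_mod_cast h2
      linarith
  -- The definition fixes one instance of finiteness of `V \ I`; the argument works for any.
  suffices ∀ inst : Fintype ↥((I : Set V)ᶜ),
      @HasFractionalFactor _ inst (G.induce (I : Set V)ᶜ) a b from this _
  intro inst
  refine hasFractionalFactor_of_card_neighborFinset_union _ (m := m) (i := #I) hab hbm hIcard
    ?_ ?_ ?_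
  · have h1 : Fintype.card ↥((I : Set V)ᶜ) + #I = n := by
      rw [← hcard, ← Finset.card_compl_add_card I]
      congr 1
      rw [← Set.toFinset_card]
      congr 1
      ext
      simp
    have h2 : (Fintype.card ↥((I : Set V)ᶜ) : ℝ) + #I = n := by exact_mod_cast h1
    linarith
  · intro x
    have h1 := G.card_neighborFinset_union_le_induce_compl I x x
    rw [union_self, union_self, card_neighborFinset_eq_degree, card_neighborFinset_eq_degree] at h1
    have h2 : (G.minDegree : ℝ) ≤ #I + (G.induce (I : Set V)ᶜ).degree x := by
      exact_mod_cast (G.minDegree_le_degree x).trans h1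
    have h3 : (a : ℝ) ≤ (G.induce (I : Set V)ᶜ).degree x := by linarith
    exact_mod_cast h3
  · intro x y hxy hadj
    have h1 := hnbr x y (Subtype.coe_injective.ne hxy) (by simpa using hadj)
    have h2 : (#(G.neighborFinset x ∪ G.neighborFinset y) : ℝ) ≤
        #I + #((G.induce (I : Set V)ᶜ).neighborFinset x ∪
          (G.induce (I : Set V)ᶜ).neighborFinset y) := by
      exact_mod_cast G.card_neighborFinset_union_le_induce_compl I x y
    linarith
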